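/- Let $p,s,K,n_T,n_S$ be nonnegative integers with $n_T\ge 1$, let $N=Kn_S+n_T$, let $h_1,\dots,h_K\ge 0$ and $\bar h=\frac{n_S}{N}\sum_{k=1}^K h_k$. We observe samples from $K+1$ linear models $$y_i^{(k)}=\langle X_i^{(k)},\beta^{(k)}\rangle+\epsilon_i^{(k)},\qquad 0\le k\le K,$$ with $n_T$ observations for the target task $k=0$ and $n_S$ observations for each source task $k=1,\dots,K$. The covariates $X_i^{(k)}\in\mathbb R^p$ are, within each task, independent sub-Gaussian random vectors with mean zero and covariance matrix $\Sigma^{(k)}$, all of whose eigenvalues lie in $[1/\kappa,\kappa]$. The errors $\epsilon_i^{(k)}$ are jointly independent centered Gaussian variables, independent of the covariates, with variances in $[1/\tau,\tau]$. The parameter $\beta=(\beta^{(0)},\dots,\beta^{(K)})$ belongs to $$\Theta(s,\mathbf h)=\{\beta:\ \|\beta^{(0)}\|_0\le s,\ \|\beta^{(k)}-\beta^{(0)}\|_1\le h_k\ \text{ for } 1\le k\le K\}.$$ For all constants $\kappa,\tau,\alpha,\gamma>0$ there are constants $c,\delta>0$, depending only on $\kappa,\tau,\alpha,\gamma$, such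 that the following holds. Suppose that $p\gg s$ in the sense that $s\le p^{1-\gamma}$, that $N\gg s\log p$ in the sense that $s\log p\le\delta N$, that $h_k\asymp\bar h$ in the sense that $\bar h/\alpha\le h_k\le\alpha\bar h$ for all $k$, and that $\bar h\sqrt{\log p/n_T}\le\delta$. Then for all covariate and error distributions as above and for every estimator $\hat\beta'$ of $\beta^{(0)}$ that is a measurable function of the sample $\{(X^{(k)},y^{(k)})\}_{0\le k\le K}$, there is some $\beta\in\Theta(s,\mathbf h)$ such that, when the sample is generated with parameter $\beta$, $$\big\|\hat\beta'-\beta^{(0)}\big\|_2^2\ \ge\ c\left(\frac{s\log p}{N}+\frac{s\log p}{n_T}\wedge\bar h\sqrt{\frac{\log p}{n_T}}\wedge\bar h^2\right)$$ with probability at least $1/2$. -/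

import Mathlib

open MeasureTheory ProbabilityTheory
open scoped NNReal

namespace TransferRegression

/-- Index set of all observations: `nT` target observations and, for each of the `K` sources,
`nS` source observations. -/
abbrev Obs (K nT nS : ℕ) : Type := Fin nT ⊕ (Fin K × Fin nS)

/-- The task of an observation: `0` is the target task, `k + 1` is the `k`-th source task. -/
def task {K nT nS : ℕ} : Obs K nT nS → Fin (K + 1)
  | Sum.inl _ => 0
  | Sum.inr ki => ki.1.succ

/-- Total sample size `N = K nS + nT`. -/
def totalSize (K nT nS : ℕ) : ℕ := K * nS + nT

/-- The averaged shift `hbar = (nS / N) ∑ k, h k`. -/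
noncomputable def hbar {K : ℕ} (nT nS : ℕ) (h : Fin K → ℝ) : ℝ :=
  (nS : ℝ) / (totalSize K nT nS : ℝ) * ∑ k, h k

/-- The parameter space: the target parameter `β 0` has at most `s` nonzero coordinates, and the
`k`-th source parameter is within `ℓ¹`-distance `h k` of it. -/
def paramSpace {K : ℕ} (p s : ℕ) (h : Fin K → ℝ) :
    Set (Fin (K + 1) → EuclideanSpace ℝ (Fin p)) :=
  {β | {j | β 0 j ≠ 0}.ncard ≤ s ∧ ∀ k : Fin K, ∑ j, |β k.succ j - β 0 j| ≤ h k}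

/-- The observed data `(X, y)` under the parameter `β`, with `y_i = ⟨X_i, β^(task of i)⟩ + ε_i`. -/
noncomputable def sample {K nT nS p : ℕ} {Ω : Type*}
    (X : Obs K nT nS → Ω → EuclideanSpace ℝ (Fin p)) (ε : Obs K nT nS → Ω → ℝ)
    (β : Fin (K + 1) → EuclideanSpace ℝ (Fin p)) (ω : Ω) :
    Obs K nT nS → EuclideanSpace ℝ (Fin p) × ℝ :=
  fun i => (X i ω, inner ℝ (X i ω) (β (task i)) + ε i ω)

/-- A random vector is sub-Gaussian: its one-dimensional marginals in unit directions are
sub-Gaussian with a common variance proxy. (Applied to centered vectors.) -/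
def IsSubGaussianVec {p : ℕ} {Ω : Type*} [MeasurableSpace Ω] (P : Measure Ω)
    (Z : Ω → EuclideanSpace ℝ (Fin p)) : Prop :=
  ∃ L : ℝ≥0, ∀ u : EuclideanSpace ℝ (Fin p), ‖u‖ = 1 →
    HasSubgaussianMGF (fun ω => inner ℝ u (Z ω)) L P

/-- Sub-Gaussian designs: within each task the covariate vectors are independent, sub-Gaussian,
centered, with covariance matrix `Sig k` depending only on the task, and all eigenvalues of the
`Sig k` lie in `[1/κ, κ]` (expressed by the Rayleigh quotients). -/
structure IsSubGaussianDesign {K nT nS p : ℕ} {Ω : Type*} [MeasurableSpace Ω] (P : Measure Ω)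
    (X : Obs K nT nS → Ω → EuclideanSpace ℝ (Fin p))
    (Sig : Fin (K + 1) → Matrix (Fin p) (Fin p) ℝ) (κ : ℝ) : Prop where
  measurable : ∀ i, Measurable (X i)
  indep : ∀ k : Fin (K + 1), iIndepFun (fun i : {i : Obs K nT nS // task i = k} => X i.1) P
  subGaussian : ∀ i, IsSubGaussianVec P (X i)
  centered : ∀ i j, ∫ ω, X i ω j ∂P = 0
  covariance : ∀ i a b, ∫ ω, X i ω a * X i ω b ∂P = Sig (task i) a b
  symmetric : ∀ k, (Sig k).IsSymm
  eigenvalues : ∀ k (u : Fin p → ℝ),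
    (1 / κ) * (u ⬝ᵥ u) ≤ u ⬝ᵥ (Sig k).mulVec u ∧ u ⬝ᵥ (Sig k).mulVec u ≤ κ * (u ⬝ᵥ u)

/-- Gaussian errors: the errors of all tasks are jointly independent centered Gaussians,
independent of the covariates, with variances in `[1/τ, τ]`. -/
structure IsGaussianNoise {K nT nS p : ℕ} {Ω : Type*} [MeasurableSpace Ω] (P : Measure Ω)
    (X : Obs K nT nS → Ω → EuclideanSpace ℝ (Fin p)) (ε : Obs K nT nS → Ω → ℝ)
    (v : Obs K nT nS → ℝ≥0) (τ : ℝ) : Prop where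
  measurable : ∀ i, Measurable (ε i)
  law : ∀ i, P.map (ε i) = gaussianReal 0 (v i)
  indep : iIndepFun ε P
  indep_design : IndepFun (fun ω i => ε i ω) (fun ω i => X i ω) P
  variance : ∀ i, 1 / τ ≤ (v i : ℝ) ∧ (v i : ℝ) ≤ τ

/-- `s log p / N + min (s log p / nT) (hbar √(log p / nT)) (hbar ²)`. -/
noncomputable def rate {K : ℕ} (p s nT nS : ℕ) (h : Fin K → ℝ) : ℝ :=
  (s : ℝ) * Real.log p / (totalSize K nT nS : ℝ) +
    min ((s : ℝ) * Real.log p / (nT : ℝ))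
      (min (hbar nT nS h * √(Real.log p / (nT : ℝ))) (hbar nT nS h ^ 2))

end TransferRegression

namespace TransferRegression

/-! The bound is Fano-type, with the zero parameter as reference. Put many `m`-sparse vectors `b_w`
of amplitude at most `r` on the tasks of a set `T`, zero on the others. Given the covariates, the
sample law is a shifted Gaussian product, whose likelihood ratio against the null has second moment
`exp (∑ m_i² / v_i)`. By Markov's inequality the exponent is of order `κ τ n m r²` with good
probability, where `n` bounds the number of observations from tasks in `T` (`measure_sample_mem_le`,
`measureReal_le_sum_inner_sq`).

Under the null, the events "the estimator is close to `b_w`" cannot all be likely: a point is close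
only to the `b_w` whose words lie in one Hamming ball, a tiny fraction of the family
(`card_hammingDist_le`, `sum_indicator_sparseVector_le`). No packing has to be extracted. Hence some
`b_w` is missed with probability at least `1/2`, with squared error of order `m r²`, provided `n r²`
is at most a constant times `log p` (`exists_sparse_lower_bound`).

The two terms of the rate come from two families. If all tasks share the vector, then `n = N` and `m
= s` give `s log p / N`. If only the target carries it, then `n = nT`, and the `ℓ¹` constraint `m r
≤ hbar / α ≤ h k` gives the minimum of three terms. The larger term is at least half of the sum. -/

/-! ### Product densities and the χ²-cost of shifting Gaussian noise. -/

theorem lintegral_pi_prod {ι : Type*} [Fintype ι] {μ : ι → Measure ℝ}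
    [∀ i, IsProbabilityMeasure (μ i)] {f : ι → ℝ → ENNReal} (hf : ∀ i, Measurable (f i)) :
    ∫⁻ x, ∏ i, f i (x i) ∂Measure.pi μ = ∏ i, ∫⁻ y, f i y ∂μ i := by
  have hind : iIndepFun (fun i (x : ι → ℝ) => f i (x i)) (Measure.pi μ) :=
    iIndepFun_pi (fun i => (hf i).aemeasurable)
  have h := lintegral_prod_eq_prod_lintegral_of_indepFun Finset.univ
    (fun i (x : ι → ℝ) => f i (x i)) hind (fun i => (hf i).comp (measurable_pi_apply i))
  refine h.trans ?_
  refine Finset.prod_congr rfl fun i _ => ?_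
  exact (measurePreserving_eval μ i).lintegral_comp (hf i)

/-- Boxes determine the product measure, and on a box the indicator factorises along with the
density. -/
theorem pi_withDensity {ι : Type*} [Fintype ι] {μ : ι → Measure ℝ}
    [∀ i, IsProbabilityMeasure (μ i)] {f : ι → ℝ → ENNReal} (hf : ∀ i, Measurable (f i))
    [∀ i, SigmaFinite ((μ i).withDensity (f i))] :
    Measure.pi (fun i => (μ i).withDensity (f i)) =
      (Measure.pi μ).withDensity fun x => ∏ i, f i (x i) := by
  refine Measure.pi_eq fun s hs => ?_
  rw [withDensity_apply _ (MeasurableSet.univ_pi hs),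
    ← lintegral_indicator (MeasurableSet.univ_pi hs)]
  have h : ∀ x : ι → ℝ, (Set.univ.pi s).indicator (fun x => ∏ i, f i (x i)) x =
      ∏ i, (s i).indicator (f i) (x i) := by
    intro x
    by_cases hx : x ∈ Set.univ.pi s
    · rw [Set.indicator_of_mem hx]
      exact Finset.prod_congr rfl fun i _ => (Set.indicator_of_mem (hx i trivial) _).symm
    · rw [Set.indicator_of_notMem hx]
      simp only [Set.mem_pi, Set.mem_univ, true_implies, not_forall] at hx
      obtain ⟨i, hi⟩ := hx
      exact (Finset.prod_eq_zero (Finset.mem_univ i) (Set.indicator_of_notMem hi _)).symm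
  simp_rw [h]
  rw [lintegral_pi_prod fun i => (hf i).indicator (hs i)]
  refine Finset.prod_congr rfl fun i _ => ?_
  rw [withDensity_apply _ (hs i), lintegral_indicator (hs i)]

/-- The density of `N(m, v)` with respect to `N(0, v)`. -/
noncomputable def gaussianShiftDensity (v : ℝ≥0) (m y : ℝ) : ENNReal :=
  ENNReal.ofReal (Real.exp (m * y / v - m ^ 2 / (2 * v)))

theorem measurable_gaussianShiftDensity (v : ℝ≥0) (m : ℝ) :
    Measurable (gaussianShiftDensity v m) := by
  unfold gaussianShiftDensity
  fun_prop

theorem gaussianReal_map_add_eq_withDensity {v : ℝ≥0} (hv : v ≠ 0) (m : ℝ) :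
    (gaussianReal 0 v).map (fun y => m + y) =
      (gaussianReal 0 v).withDensity (gaussianShiftDensity v m) := by
  have hv' : (v : ℝ) ≠ 0 := by exact_mod_cast hv
  rw [gaussianReal_map_const_add, gaussianReal_of_var_ne_zero _ hv,
    gaussianReal_of_var_ne_zero _ hv,
    ← withDensity_mul _ (measurable_gaussianPDF _ _) (measurable_gaussianShiftDensity v m)]
  congr 1
  funext y
  simp only [Pi.mul_apply, gaussianPDF, gaussianShiftDensity, gaussianPDFReal]
  rw [← ENNReal.ofReal_mul (by positivity), mul_assoc (√(2 * Real.pi * v))⁻¹, ← Real.exp_add]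
  congr 3
  field_simp
  ring

/-- The squared density is again an exponential of a linear function of `y`, so this is the Gaussian
moment generating function at `2 m / v`. -/
theorem lintegral_gaussianShiftDensity_sq {v : ℝ≥0} (hv : v ≠ 0) (m : ℝ) :
    ∫⁻ y, gaussianShiftDensity v m y ^ 2 ∂gaussianReal 0 v =
      ENNReal.ofReal (Real.exp (m ^ 2 / v)) := by
  have hv' : (v : ℝ) ≠ 0 := by exact_mod_cast hv
  have h : ∀ y, gaussianShiftDensity v m y ^ 2 =
      ENNReal.ofReal (Real.exp (-(m ^ 2 / v)) * Real.exp (2 * m / v * y)) := by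
    intro y
    rw [gaussianShiftDensity, ← ENNReal.ofReal_pow (Real.exp_pos _).le, ← Real.exp_nat_mul,
      ← Real.exp_add]
    congr 2
    push_cast
    field_simp
    ring
  simp_rw [h]
  rw [← ofReal_integral_eq_lintegral_ofReal
    ((integrable_exp_mul_gaussianReal _).const_mul _) (ae_of_all _ fun y => by positivity),
    integral_const_mul]
  have hm := mgf_gaussianReal (p := gaussianReal 0 v) (X := id) (μ := 0) (v := v)
    (by simp) (2 * m / v)
  simp only [mgf, id] at hm
  rw [hm, ← Real.exp_add]
  congr 2
  field_simp
  ring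

/-- This is `(x - a)² ≥ 0`. Applied to a likelihood ratio, it splits a probability into `a / 2`
times the null probability and a second moment; `a` is tuned later. -/
theorem ennreal_le_half_mul_add (a : ℝ) (ha : 0 < a) (x : ENNReal) :
    x ≤ ENNReal.ofReal (a / 2) + ENNReal.ofReal (1 / (2 * a)) * x ^ 2 := by
  induction x using ENNReal.recTopCoe with
  | top =>
    have : ENNReal.ofReal (1 / (2 * a)) ≠ 0 := by
      simp only [ne_eq, ENNReal.ofReal_eq_zero, not_le]; positivity
    rw [ENNReal.top_pow two_ne_zero, ENNReal.mul_top this, add_top]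
  | coe x =>
    rw [← ENNReal.ofReal_coe_nnreal, ← ENNReal.ofReal_pow x.coe_nonneg,
      ← ENNReal.ofReal_mul (by positivity), ← ENNReal.ofReal_add (by positivity) (by positivity)]
    refine ENNReal.ofReal_le_ofReal ?_
    have : a / 2 + 1 / (2 * a) * (x : ℝ) ^ 2 - x = (x - a) ^ 2 / (2 * a) := by
      field_simp; ring
    have h2 : 0 ≤ ((x : ℝ) - a) ^ 2 / (2 * a) := by positivity
    linarith

/-- Shifting a centered Gaussian product measure by `m` increases probabilities in a way
controlled by the `χ²`-divergence `exp (∑ i, m i ^ 2 / v i) - 1`. -/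
theorem pi_gaussianReal_shift_le {ι : Type*} [Fintype ι] {v : ι → ℝ≥0} (hv : ∀ i, v i ≠ 0)
    (m : ι → ℝ) {B : Set (ι → ℝ)} (hB : MeasurableSet B) {a : ℝ} (ha : 0 < a) :
    Measure.pi (fun i => gaussianReal 0 (v i)) ((fun e => m + e) ⁻¹' B) ≤
      ENNReal.ofReal (a / 2) * Measure.pi (fun i => gaussianReal 0 (v i)) B +
        ENNReal.ofReal (1 / (2 * a)) * ENNReal.ofReal (Real.exp (∑ i, m i ^ 2 / v i)) := by
  set ν : Measure (ι → ℝ) := Measure.pi fun i => gaussianReal 0 (v i) with hν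
  have hprob : ∀ i, IsProbabilityMeasure
      ((gaussianReal 0 (v i)).withDensity (gaussianShiftDensity (v i) (m i))) := by
    intro i
    rw [← gaussianReal_map_add_eq_withDensity (hv i)]
    exact Measure.isProbabilityMeasure_map (by fun_prop)
  have hmap : ν.map (fun e => m + e) =
      ν.withDensity fun x => ∏ i, gaussianShiftDensity (v i) (m i) (x i) := by
    rw [hν, ← pi_withDensity fun i => measurable_gaussianShiftDensity (v i) (m i)]
    have : ∀ i, SigmaFinite ((gaussianReal 0 (v i)).map fun y => m i + y) := by
      intro i
      rw [gaussianReal_map_const_add]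
      infer_instance
    have h := Measure.pi_map_pi (μ := fun i => gaussianReal 0 (v i))
      (f := fun i y => m i + y) (fun i => by fun_prop)
    simp_rw [← gaussianReal_map_add_eq_withDensity (hv _)]
    exact h
  have hmeas : Measurable fun x : ι → ℝ => ∏ i, gaussianShiftDensity (v i) (m i) (x i) :=
    Finset.measurable_prod _ fun i _ =>
      (measurable_gaussianShiftDensity _ _).comp (measurable_pi_apply i)
  rw [← Measure.map_apply (by fun_prop) hB, hmap, withDensity_apply _ hB]
  calc ∫⁻ x in B, ∏ i, gaussianShiftDensity (v i) (m i) (x i) ∂ν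
      ≤ ∫⁻ x in B, ENNReal.ofReal (a / 2) + ENNReal.ofReal (1 / (2 * a)) *
          (∏ i, gaussianShiftDensity (v i) (m i) (x i)) ^ 2 ∂ν :=
        lintegral_mono fun x => ennreal_le_half_mul_add a ha _
    _ = ENNReal.ofReal (a / 2) * ν B + ENNReal.ofReal (1 / (2 * a)) *
          ∫⁻ x in B, (∏ i, gaussianShiftDensity (v i) (m i) (x i)) ^ 2 ∂ν := by
        rw [lintegral_add_left (by fun_prop), lintegral_const_mul _ (hmeas.pow_const 2)]
        simp
    _ ≤ _ := by
        gcongr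
        refine (setLIntegral_le_lintegral _ _).trans (le_of_eq ?_)
        simp_rw [← Finset.prod_pow]
        rw [hν, lintegral_pi_prod fun i => (measurable_gaussianShiftDensity _ _).pow_const 2]
        simp_rw [lintegral_gaussianShiftDensity_sq (hv _)]
        rw [Real.exp_sum, ENNReal.ofReal_prod_of_nonneg fun i _ => (Real.exp_pos _).le]

/-! ### The law of the sample: conditioning on the design, and second moments of the signal. -/

section Sample

variable {K nT nS p : ℕ} {Ω : Type*} [MeasurableSpace Ω] {P : Measure Ω}
  {X : Obs K nT nS → Ω → EuclideanSpace ℝ (Fin p)} {ε : Obs K nT nS → Ω → ℝ}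
  {v : Obs K nT nS → ℝ≥0} {Sig : Fin (K + 1) → Matrix (Fin p) (Fin p) ℝ} {κ τ : ℝ}

theorem measurable_sample (hX : ∀ i, Measurable (X i)) (hε : ∀ i, Measurable (ε i))
    (β : Fin (K + 1) → EuclideanSpace ℝ (Fin p)) : Measurable (sample X ε β) :=
  measurable_pi_lambda _ fun i =>
    (hX i).prodMk ((Measurable.inner (hX i) measurable_const).add (hε i))

/-- The law of the sample under `β` is controlled by its law under the null parameter. -/
theorem measure_sample_mem_le [IsProbabilityMeasure P] (hτ : 0 < τ) (hX : ∀ i, Measurable (X i))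
    (hε : IsGaussianNoise P X ε v τ) (β : Fin (K + 1) → EuclideanSpace ℝ (Fin p))
    {A : Set (Obs K nT nS → EuclideanSpace ℝ (Fin p) × ℝ)} (hA : MeasurableSet A)
    (d : ℝ) {a : ℝ} (ha : 0 < a) :
    P {ω | sample X ε β ω ∈ A} ≤
      P {ω | d ≤ ∑ i, (inner ℝ (X i ω) (β (task i))) ^ 2 / (v i : ℝ)} +
        (ENNReal.ofReal (a / 2) * P {ω | sample X ε 0 ω ∈ A} +
          ENNReal.ofReal (1 / (2 * a)) * ENNReal.ofReal (Real.exp d)) := by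
  have hv : ∀ i, v i ≠ 0 := by
    intro i h0
    have h1 := (hε.variance i).1
    rw [h0] at h1
    have : 0 < 1 / τ := by positivity
    simp only [NNReal.coe_zero] at h1
    linarith
  set ν : Measure (Obs K nT nS → ℝ) := Measure.pi fun i => gaussianReal 0 (v i) with hν
  have hXm : Measurable fun ω i => X i ω := measurable_pi_lambda _ hX
  have hεm : Measurable fun ω i => ε i ω := measurable_pi_lambda _ hε.measurable
  set μ := P.map fun ω i => X i ω with hμ
  have : IsProbabilityMeasure μ := Measure.isProbabilityMeasure_map hXm.aemeasurable
  have hlaw : P.map (fun ω => ((fun i => X i ω), fun i => ε i ω)) = μ.prod ν := by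
    rw [(indepFun_iff_map_prod_eq_prod_map_map hXm.aemeasurable hεm.aemeasurable).1
      hε.indep_design.symm,
      (iIndepFun_iff_map_fun_eq_pi_map fun i => (hε.measurable i).aemeasurable).1 hε.indep]
    simp_rw [hε.law]
    rfl
  let G (b : Fin (K + 1) → EuclideanSpace ℝ (Fin p))
      (z : (Obs K nT nS → EuclideanSpace ℝ (Fin p)) × (Obs K nT nS → ℝ)) :
      Obs K nT nS → EuclideanSpace ℝ (Fin p) × ℝ :=
    fun i => (z.1 i, inner ℝ (z.1 i) (b (task i)) + z.2 i)
  have hG : ∀ b, Measurable (G b) := fun b => by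
    refine measurable_pi_lambda _ fun i => ?_
    have h1 : Measurable fun z : (Obs K nT nS → EuclideanSpace ℝ (Fin p)) ×
        (Obs K nT nS → ℝ) => z.1 i := (measurable_pi_apply i).comp measurable_fst
    have h2 : Measurable fun z : (Obs K nT nS → EuclideanSpace ℝ (Fin p)) ×
        (Obs K nT nS → ℝ) => z.2 i := (measurable_pi_apply i).comp measurable_snd
    exact h1.prodMk ((Measurable.inner h1 measurable_const).add h2)
  -- Independence of design and errors lets the probability be computed by fixing the covariates `x`
  -- and integrating over the noise.
  have hP : ∀ b, P {ω | sample X ε b ω ∈ A} =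
      ∫⁻ x, ν (Prod.mk x ⁻¹' (G b ⁻¹' A)) ∂μ := by
    intro b
    rw [← Measure.prod_apply (hG b hA), ← hlaw,
      Measure.map_apply (hXm.prodMk hεm) (hG b hA)]
    rfl
  have hDm : Measurable fun x : Obs K nT nS → EuclideanSpace ℝ (Fin p) =>
      ∑ i, (inner ℝ (x i) (β (task i))) ^ 2 / (v i : ℝ) :=
    Finset.measurable_sum _ fun i _ =>
      ((Measurable.inner (measurable_pi_apply i) measurable_const).pow_const 2).div_const _
  let S : Set (Obs K nT nS → EuclideanSpace ℝ (Fin p)) :=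
    {x | d ≤ ∑ i, (inner ℝ (x i) (β (task i))) ^ 2 / (v i : ℝ)}
  have hS : MeasurableSet S := measurableSet_le measurable_const hDm
  have hPS : P {ω | d ≤ ∑ i, (inner ℝ (X i ω) (β (task i))) ^ 2 / (v i : ℝ)} =
      ∫⁻ x, S.indicator 1 x ∂μ := by
    rw [lintegral_indicator_one hS, hμ, Measure.map_apply hXm hS]
    rfl
  -- For fixed covariates, `β` merely translates the noise. Designs with signal energy at least `d`
  -- are given up with the trivial bound `1`; on the others the shift costs at most `exp d`.
  have hpt : ∀ x, ν (Prod.mk x ⁻¹' (G β ⁻¹' A)) ≤ S.indicator 1 x +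
      (ENNReal.ofReal (a / 2) * ν (Prod.mk x ⁻¹' (G 0 ⁻¹' A)) +
        ENNReal.ofReal (1 / (2 * a)) * ENNReal.ofReal (Real.exp d)) := by
    intro x
    by_cases hx : x ∈ S
    · rw [Set.indicator_of_mem hx]
      exact prob_le_one.trans le_self_add
    · have hx' : ∑ i, (inner ℝ (x i) (β (task i))) ^ 2 / (v i : ℝ) ≤ d := by
        have : ¬ d ≤ _ := hx
        exact (not_le.1 this).le
      rw [Set.indicator_of_notMem hx, zero_add]
      have hB : MeasurableSet (Prod.mk x ⁻¹' (G 0 ⁻¹' A)) :=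
        measurable_prodMk_left (hG 0 hA)
      have key := pi_gaussianReal_shift_le hv (fun i => inner ℝ (x i) (β (task i))) hB ha
      have hpre : (fun e => (fun i => inner ℝ (x i) (β (task i))) + e) ⁻¹'
          (Prod.mk x ⁻¹' (G 0 ⁻¹' A)) = Prod.mk x ⁻¹' (G β ⁻¹' A) := by
        ext e
        simp [G]
      rw [hpre] at key
      refine key.trans ?_
      gcongr
  rw [hP β, hP 0, hPS]
  have hm0 : Measurable fun x => ν (Prod.mk x ⁻¹' (G 0 ⁻¹' A)) :=
    measurable_measure_prodMk_left (hG 0 hA)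
  calc _ ≤ _ := lintegral_mono hpt
    _ = _ := by
      rw [lintegral_add_left (measurable_one.indicator hS), lintegral_add_right _ measurable_const,
        lintegral_const_mul _ hm0]
      simp

theorem IsSubGaussianDesign.memLp_coord (hX : IsSubGaussianDesign P X Sig κ) (i : Obs K nT nS)
    (j : Fin p) : MemLp (fun ω => X i ω j) 2 P := by
  obtain ⟨L, hL⟩ := hX.subGaussian i
  have h := (hL (EuclideanSpace.single j 1) (by simp)).memLp 2
  simpa [EuclideanSpace.inner_single_left] using h

theorem IsSubGaussianDesign.integral_inner_sq_le (hX : IsSubGaussianDesign P X Sig κ)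
    (i : Obs K nT nS) (u : EuclideanSpace ℝ (Fin p)) :
    Integrable (fun ω => (inner ℝ (X i ω) u) ^ 2) P ∧
      ∫ ω, (inner ℝ (X i ω) u) ^ 2 ∂P ≤ κ * ‖u‖ ^ 2 := by
  have hint : ∀ a b, Integrable (fun ω => X i ω a * X i ω b) P := fun a b =>
    (hX.memLp_coord i a).integrable_mul (hX.memLp_coord i b)
  have hexp : ∀ ω, (inner ℝ (X i ω) u) ^ 2 = ∑ a, ∑ b, u a * u b * (X i ω a * X i ω b) := by
    intro ω
    rw [PiLp.inner_apply, sq, Finset.sum_mul_sum]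
    refine Finset.sum_congr rfl fun a _ => Finset.sum_congr rfl fun b _ => ?_
    simp only [RCLike.inner_apply, conj_trivial]
    ring
  simp_rw [hexp]
  refine ⟨integrable_finsetSum _ fun a _ => integrable_finsetSum _ fun b _ =>
    (hint a b).const_mul _, ?_⟩
  rw [integral_finsetSum _ fun a _ => integrable_finsetSum _ fun b _ => (hint a b).const_mul _]
  simp_rw [integral_finsetSum _ fun b _ => (hint _ b).const_mul _, integral_const_mul,
    hX.covariance]
  have h := (hX.eigenvalues (task i) u).2
  have h1 : (u : Fin p → ℝ) ⬝ᵥ u = ‖u‖ ^ 2 := by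
    rw [EuclideanSpace.norm_sq_eq]
    simp [dotProduct, sq]
  rw [h1] at h
  refine le_of_eq_of_le ?_ h
  simp only [dotProduct, Matrix.mulVec, Finset.mul_sum]
  exact Finset.sum_congr rfl fun a _ => Finset.sum_congr rfl fun b _ => by ring

/-- Markov's inequality: the eigenvalue bound gives the factor `κ`, and `1 / v i ≤ τ` gives the
other. -/
theorem measureReal_le_sum_inner_sq (hτ : 0 < τ) (hX : IsSubGaussianDesign P X Sig κ)
    (hε : IsGaussianNoise P X ε v τ) (β : Fin (K + 1) → EuclideanSpace ℝ (Fin p))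
    {d : ℝ} (hd : 0 < d) :
    P.real {ω | d ≤ ∑ i, (inner ℝ (X i ω) (β (task i))) ^ 2 / (v i : ℝ)} ≤
      (κ * τ * ∑ i : Obs K nT nS, ‖β (task i)‖ ^ 2) / d := by
  have hint : ∀ i ∈ Finset.univ,
      Integrable (fun ω => (inner ℝ (X i ω) (β (task i))) ^ 2 / (v i : ℝ)) P :=
    fun i _ => (hX.integral_inner_sq_le i _).1.div_const _
  have hmk := mul_meas_ge_le_integral_of_nonneg (μ := P)
    (f := fun ω => ∑ i, (inner ℝ (X i ω) (β (task i))) ^ 2 / (v i : ℝ))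
    (ae_of_all _ fun ω => Finset.sum_nonneg fun i _ => by positivity)
    (integrable_finsetSum _ hint) d
  rw [le_div_iff₀ hd, mul_comm]
  refine hmk.trans ?_
  rw [integral_finsetSum _ hint, Finset.mul_sum]
  refine Finset.sum_le_sum fun i _ => ?_
  have h1 := (hX.integral_inner_sq_le i (β (task i))).2
  have h0 : 0 ≤ ∫ ω, (inner ℝ (X i ω) (β (task i))) ^ 2 ∂P := integral_nonneg fun ω => sq_nonneg _
  have hv := (hε.variance i).1
  have hτ' : 0 < 1 / τ := by positivity
  rw [integral_div, div_le_iff₀ (by linarith)]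
  have h2 : 1 ≤ τ * v i := by
    have := mul_le_mul_of_nonneg_left hv hτ.le
    rwa [mul_one_div_cancel hτ.ne'] at this
  nlinarith [h0.trans h1]

end Sample

/-! ### A Fano-type inequality. -/

/-- The probabilities of sets of which every point lies in at most `V` sum to at most `V`. -/
theorem sum_measureReal_le_of_overlap {W Ω : Type*} [Fintype W] [MeasurableSpace Ω]
    {P : Measure Ω} [IsProbabilityMeasure P] {A : W → Set Ω} (hA : ∀ w, MeasurableSet (A w))
    {V : ℝ} (hV : ∀ ω, ∑ w, (A w).indicator (fun _ => (1 : ℝ)) ω ≤ V) :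
    ∑ w, P.real (A w) ≤ V := by
  have h : ∀ w, P.real (A w) = ∫ ω, (A w).indicator (fun _ => (1 : ℝ)) ω ∂P := fun w => by
    rw [integral_indicator (hA w)]
    simp
  have hint : ∀ w ∈ Finset.univ, Integrable ((A w).indicator fun _ => (1 : ℝ)) P := fun w _ =>
    (integrable_const _).indicator (hA w)
  simp_rw [h]
  rw [← integral_finsetSum _ hint]
  calc _ ≤ ∫ _, V ∂P := integral_mono (integrable_finsetSum _ hint) (integrable_const _) hV
    _ = V := by simp

/-- A Bayesian form of Fano's inequality in the regression model: if the sets `A w` overlap at most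
`V` times and the parameters `β w` are close to zero, then some `A w` has probability at most
`1/2` under `β w`. -/
theorem exists_measureReal_sample_le_half {K nT nS p : ℕ} {Ω : Type*} [MeasurableSpace Ω]
    {P : Measure Ω} [IsProbabilityMeasure P]
    {X : Obs K nT nS → Ω → EuclideanSpace ℝ (Fin p)} {ε : Obs K nT nS → Ω → ℝ}
    {v : Obs K nT nS → ℝ≥0} {Sig : Fin (K + 1) → Matrix (Fin p) (Fin p) ℝ} {κ τ : ℝ}
    (hτ : 0 < τ) (hX : IsSubGaussianDesign P X Sig κ) (hε : IsGaussianNoise P X ε v τ)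
    {W : Type*} [Fintype W] [Nonempty W] (β : W → Fin (K + 1) → EuclideanSpace ℝ (Fin p))
    {A : W → Set (Obs K nT nS → EuclideanSpace ℝ (Fin p) × ℝ)} (hA : ∀ w, MeasurableSet (A w))
    {V l : ℝ} (hV : ∀ y, ∑ w, (A w).indicator (fun _ => (1 : ℝ)) y ≤ V)
    (hVl : V ≤ Fintype.card W * Real.exp (-l)) (hl : 256 ≤ Real.exp l)
    (hβ : ∀ w, κ * τ * ∑ i : Obs K nT nS, ‖β w (task i)‖ ^ 2 ≤ l / 8) :
    ∃ w, P.real {ω | sample X ε (β w) ω ∈ A w} ≤ 1 / 2 := by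
  by_contra! hcon
  have hl0 : 0 < l := by
    by_contra! h
    have := Real.exp_le_one_iff.2 h
    linarith
  -- With `d = l / 2` and `a = t ^ 3`, the mean over `w` is at most `1 / 4` (Markov) plus `t ^ 3 / 2
  -- * t ^ (-4)` (overlap) plus `t ^ 2 / (2 * t ^ 3)` (χ²), that is `1 / 4 + 1 / t`. It is at most
  -- `1 / 2` once `t ≥ 4`, which is the reason for `256 = 4 ^ 4`.
  set t := Real.exp (l / 4) with ht
  have htpos : 0 < t := Real.exp_pos _
  have ht4 : Real.exp l = t ^ 4 := by rw [ht, ← Real.exp_nat_mul]; congr 1; push_cast; ring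
  have ht2 : Real.exp (l / 2) = t ^ 2 := by rw [ht, ← Real.exp_nat_mul]; congr 1; push_cast; ring
  have htge : 4 ≤ t := by
    by_contra! h
    have : t ^ 4 < 4 ^ 4 := pow_lt_pow_left₀ h htpos.le (by norm_num)
    rw [ht4] at hl
    norm_num at this
    linarith
  have ha : 0 < t ^ 3 := by positivity
  have hone : ∀ w, P.real {ω | sample X ε (β w) ω ∈ A w} ≤
      1 / 4 + t ^ 3 / 2 * P.real {ω | sample X ε 0 ω ∈ A w} + 1 / (2 * t) := by
    intro w
    have h1 := measure_sample_mem_le hτ hX.measurable hε (β w) (hA w) (l / 2) ha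
    have h2 := measureReal_le_sum_inner_sq hτ hX hε (β w) (d := l / 2) (by positivity)
    have h3 : (κ * τ * ∑ i : Obs K nT nS, ‖β w (task i)‖ ^ 2) / (l / 2) ≤ 1 / 4 := by
      rw [div_le_iff₀ (by positivity)]
      linarith [hβ w]
    have h4 := ENNReal.toReal_mono (by finiteness) h1
    rw [ENNReal.toReal_add (by finiteness) (by finiteness),
      ENNReal.toReal_add (by finiteness) (by finiteness), ENNReal.toReal_mul, ENNReal.toReal_mul,
      ENNReal.toReal_ofReal (by positivity), ENNReal.toReal_ofReal (by positivity),
      ENNReal.toReal_ofReal (by positivity), ht2] at h4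
    have h5 : 1 / (2 * t ^ 3) * t ^ 2 = 1 / (2 * t) := by field_simp
    rw [h5] at h4
    simp only [Measure.real] at h2 ⊢
    linarith
  have hover : ∑ w, P.real {ω | sample X ε 0 ω ∈ A w} ≤ V :=
    sum_measureReal_le_of_overlap
      (fun w => measurable_sample hX.measurable hε.measurable 0 (hA w))
      fun ω => hV (sample X ε 0 ω)
  have hlt : ∑ _w : W, (1 / 2 : ℝ) <
      ∑ w, (1 / 4 + t ^ 3 / 2 * P.real {ω | sample X ε 0 ω ∈ A w} + 1 / (2 * t)) :=
    Finset.sum_lt_sum_of_nonempty Finset.univ_nonempty fun w _ => (hcon w).trans_le (hone w)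
  rw [Finset.sum_add_distrib, Finset.sum_add_distrib, ← Finset.mul_sum] at hlt
  simp only [Finset.sum_const, Finset.card_univ, nsmul_eq_mul] at hlt
  have hc : (0 : ℝ) < Fintype.card W := by exact_mod_cast Fintype.card_pos
  have h6 : t ^ 3 / 2 * ∑ w, P.real {ω | sample X ε 0 ω ∈ A w} ≤
      Fintype.card W * (1 / (2 * t)) := by
    calc _ ≤ t ^ 3 / 2 * (Fintype.card W * Real.exp (-l)) := by gcongr; exact hover.trans hVl
      _ = _ := by rw [Real.exp_neg, ht4]; field_simp
  have h7 : 1 / (2 * t) ≤ 1 / 8 := by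
    rw [div_le_div_iff₀ (by positivity) (by norm_num)]; linarith
  nlinarith

/-! ### Hamming balls and the block-sparse family. -/

/-- A Chernoff count: a word within distance `m / 2` has weight at least `1` under `ρ ^ m * ρ ^ (-2
* distance)`. The total weight factorises over coordinates, each contributing at most `ρ ^ 2 * ρ ^
(-2) + 1 = 2`. -/
theorem card_hammingDist_le {α : Type*} [Fintype α] [DecidableEq α] {m : ℕ} {ρ : ℝ} (hρ : 1 ≤ ρ)
    (hcard : (Fintype.card α : ℝ) = ρ ^ 2) (w : Fin m → α) :
    ((Finset.univ.filter fun w' : Fin m → α => 2 * hammingDist w w' ≤ m).card : ℝ) ≤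
      (2 * ρ) ^ m := by
  have hρ0 : 0 < ρ := by linarith
  have hw : ∀ w', (ρ⁻¹ ^ 2) ^ hammingDist w w' = ∏ i, if w i ≠ w' i then ρ⁻¹ ^ 2 else 1 := by
    intro w'
    rw [Finset.prod_ite, Finset.prod_const, Finset.prod_const_one, mul_one, hammingDist]
  have hsum : ∑ w' : Fin m → α, (ρ⁻¹ ^ 2) ^ hammingDist w w' ≤ 2 ^ m := by
    simp_rw [hw]
    rw [← Fintype.piFinset_univ, ← Finset.prod_univ_sum (fun _ => Finset.univ)
      (fun i a => if w i ≠ a then ρ⁻¹ ^ 2 else (1 : ℝ))]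
    calc _ ≤ ∏ _i : Fin m, (2 : ℝ) := by
          refine Finset.prod_le_prod (fun i _ => Finset.sum_nonneg fun a _ => ?_) fun i _ => ?_
          · split_ifs <;> positivity
          · calc ∑ a, (if w i ≠ a then ρ⁻¹ ^ 2 else (1 : ℝ))
                ≤ ∑ a, (ρ⁻¹ ^ 2 + if w i = a then 1 else 0) := by
                  refine Finset.sum_le_sum fun a _ => ?_
                  by_cases h : w i = a
                  · simp only [h, ne_eq, not_true, if_false, if_true, le_add_iff_nonneg_left]
                    positivity
                  · simp [h]
              _ = 2 := by
                  rw [Finset.sum_add_distrib, Finset.sum_const, Finset.card_univ, nsmul_eq_mul,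
                    hcard, Finset.sum_ite_eq]
                  simp only [Finset.mem_univ, if_true]
                  field_simp
                  norm_num
      _ = 2 ^ m := by simp
  calc ((Finset.univ.filter fun w' : Fin m → α => 2 * hammingDist w w' ≤ m).card : ℝ)
      = ∑ w' with 2 * hammingDist w w' ≤ m, (1 : ℝ) := by simp
    _ ≤ ∑ w' with 2 * hammingDist w w' ≤ m, ρ ^ m * (ρ⁻¹ ^ 2) ^ hammingDist w w' := by
        refine Finset.sum_le_sum fun w' hw' => ?_
        have h := (Finset.mem_filter.1 hw').2
        rw [← pow_mul, inv_pow, ← div_eq_mul_inv, one_le_div (by positivity)]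
        exact pow_le_pow_right₀ hρ h
    _ ≤ ∑ w', ρ ^ m * (ρ⁻¹ ^ 2) ^ hammingDist w w' :=
        Finset.sum_le_sum_of_subset_of_nonneg (Finset.subset_univ _) fun _ _ _ => by positivity
    _ ≤ (2 * ρ) ^ m := by
        rw [← Finset.mul_sum, mul_pow, mul_comm]
        gcongr

section SparseVector

variable {m q L p : ℕ}

/-- The `m`-sparse vector which, in the `i`-th of `m` disjoint blocks of `q` coordinates embedded
by `e`, has the single entry `r (l + 1) / L` at position `a`, where `w i = (a, l)`. -/
noncomputable def sparseVector (e : Fin m × Fin q → Fin p) (r : ℝ)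
    (w : Fin m → Fin q × Fin L) : EuclideanSpace ℝ (Fin p) :=
  WithLp.toLp 2 (Function.extend e
    (fun x => if (w x.1).1 = x.2 then r * (((w x.1).2 : ℕ) + 1) / L else 0) 0)

variable {e : Fin m × Fin q → Fin p} {r : ℝ}

theorem sparseVector_apply (he : Function.Injective e) (w : Fin m → Fin q × Fin L)
    (x : Fin m × Fin q) :
    sparseVector e r w (e x) =
      if (w x.1).1 = x.2 then r * (((w x.1).2 : ℕ) + 1) / L else 0 := by
  simp only [sparseVector]
  rw [he.extend_apply]

theorem sparseVector_apply_of_notMem (w : Fin m → Fin q × Fin L) {j : Fin p}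
    (hj : j ∉ Set.range e) : sparseVector e r w j = 0 := by
  simp only [sparseVector]
  rw [Function.extend_apply' _ _ _ fun ⟨x, hx⟩ => hj ⟨x, hx⟩]
  rfl

theorem sum_sparseVector (he : Function.Injective e) (w : Fin m → Fin q × Fin L) {g : ℝ → ℝ}
    (hg : g 0 = 0) :
    ∑ j, g (sparseVector e r w j) = ∑ i, g (r * (((w i).2 : ℕ) + 1) / L) := by
  rw [← Fintype.sum_of_injective e he (fun x => g (sparseVector e r w (e x))) _
    (fun j hj => by rw [sparseVector_apply_of_notMem w hj, hg]) (fun _ => rfl),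
    Fintype.sum_prod_type]
  refine Finset.sum_congr rfl fun i _ => ?_
  simp only [sparseVector_apply he]
  rw [Finset.sum_eq_single (w i).1]
  · simp
  · intro a _ ha
    rw [if_neg (Ne.symm ha), hg]
  · simp

theorem sparseVector_entry_mem (hr : 0 ≤ r) (l : Fin L) :
    0 ≤ r * (((l : ℕ) : ℝ) + 1) / L ∧ r * (((l : ℕ) : ℝ) + 1) / L ≤ r := by
  have hL : (0 : ℝ) < L := by exact_mod_cast l.pos
  have hl : ((l : ℕ) : ℝ) + 1 ≤ L := by exact_mod_cast l.2
  refine ⟨by positivity, ?_⟩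
  rw [div_le_iff₀ hL]
  gcongr

theorem norm_sparseVector_sq_le (he : Function.Injective e) (hr : 0 ≤ r)
    (w : Fin m → Fin q × Fin L) : ‖sparseVector e r w‖ ^ 2 ≤ m * r ^ 2 := by
  rw [EuclideanSpace.norm_sq_eq, sum_sparseVector he w (g := fun x => ‖x‖ ^ 2) (by simp)]
  calc _ ≤ ∑ _i : Fin m, r ^ 2 := Finset.sum_le_sum fun i _ => by
        obtain ⟨h0, h1⟩ := sparseVector_entry_mem hr (w i).2
        rw [Real.norm_of_nonneg h0]
        gcongr
    _ = m * r ^ 2 := by simp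

theorem sum_abs_sparseVector_le (he : Function.Injective e) (hr : 0 ≤ r)
    (w : Fin m → Fin q × Fin L) : ∑ j, |sparseVector e r w j| ≤ m * r := by
  rw [sum_sparseVector he w (g := fun x => |x|) (by simp)]
  calc _ ≤ ∑ _i : Fin m, r := Finset.sum_le_sum fun i _ => by
        obtain ⟨h0, h1⟩ := sparseVector_entry_mem hr (w i).2
        rwa [abs_of_nonneg h0]
    _ = m * r := by simp

theorem ncard_support_sparseVector_le (he : Function.Injective e) (w : Fin m → Fin q × Fin L) :
    {j | sparseVector e r w j ≠ 0}.ncard ≤ m := by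
  have hsub : {j | sparseVector e r w j ≠ 0} ⊆
      ((Finset.univ.image fun i => e (i, (w i).1) : Finset (Fin p)) : Set (Fin p)) := by
    intro j hj
    by_cases hjr : j ∈ Set.range e
    · obtain ⟨⟨i, a⟩, rfl⟩ := hjr
      rw [Set.mem_ofPred_eq, sparseVector_apply he] at hj
      have ha : (w i).1 = a := by
        by_contra h
        exact hj (if_neg h)
      simp only [Finset.coe_image, Finset.coe_univ, Set.image_univ, Set.mem_range]
      exact ⟨i, by rw [ha]⟩
    · exact absurd (sparseVector_apply_of_notMem w hjr) hj
  refine (Set.ncard_le_ncard hsub (Finset.finite_toSet _)).trans ?_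
  rw [Set.ncard_coe_finset]
  exact Finset.card_image_le.trans (by simp)

/-- Every block where the words differ contributes at least `(r / L) ^ 2`, seen at the position
chosen by `w`: either two distinct levels meet there, or a level meets zero. Levels starting at `1`
rather than `0` make the second case work. -/
theorem hammingDist_mul_le_norm_sq (he : Function.Injective e)
    (w w' : Fin m → Fin q × Fin L) :
    (hammingDist w w' : ℝ) * (r / L) ^ 2 ≤ ‖sparseVector e r w - sparseVector e r w'‖ ^ 2 := by
  have hsub : ∀ j, (sparseVector e r w - sparseVector e r w') j =
      sparseVector e r w j - sparseVector e r w' j := fun j => rfl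
  have hone : ∀ k l : ℕ, k ≠ l →
      (r / L) ^ 2 ≤ (r * ((k : ℝ) + 1) / L - r * ((l : ℝ) + 1) / L) ^ 2 := by
    intro k l hkl
    have h1 : (1 : ℝ) ≤ ((k : ℝ) - l) ^ 2 := by
      have : (1 : ℤ) ≤ ((k : ℤ) - l) ^ 2 := by
        have : (k : ℤ) - l ≠ 0 := sub_ne_zero.2 (by exact_mod_cast hkl)
        exact sq_pos_iff.2 this
      exact_mod_cast this
    have h2 : (r * ((k : ℝ) + 1) / L - r * ((l : ℝ) + 1) / L) ^ 2 =
        (r / L) ^ 2 * ((k : ℝ) - l) ^ 2 := by ring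
    rw [h2]
    exact le_mul_of_one_le_right (sq_nonneg _) h1
  have hpos : ∀ k : ℕ, (r / L) ^ 2 ≤ (r * ((k : ℝ) + 1) / L) ^ 2 := by
    intro k
    have h2 : (r * ((k : ℝ) + 1) / L) ^ 2 = (r / L) ^ 2 * ((k : ℝ) + 1) ^ 2 := by ring
    rw [h2]
    exact le_mul_of_one_le_right (sq_nonneg _) (one_le_pow₀ (by linarith [k.cast_nonneg (α := ℝ)]))
  have hblock : ∀ i, w i ≠ w' i → (r / L) ^ 2 ≤
      ∑ a, ‖(sparseVector e r w - sparseVector e r w') (e (i, a))‖ ^ 2 := by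
    intro i hi
    refine le_trans ?_ (Finset.single_le_sum (fun a _ => by positivity)
      (Finset.mem_univ (w i).1))
    rw [hsub, sparseVector_apply he, sparseVector_apply he, Real.norm_eq_abs, sq_abs,
      if_pos rfl]
    by_cases h : (w' i).1 = (w i).1
    · rw [if_pos h]
      refine hone _ _ fun hl => hi (Prod.ext h.symm (Fin.ext hl))
    · rw [if_neg h, sub_zero]
      exact hpos _
  have hreindex : ∑ x, ‖(sparseVector e r w - sparseVector e r w') (e x)‖ ^ 2 =
      ∑ j, ‖(sparseVector e r w - sparseVector e r w') j‖ ^ 2 :=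
    Fintype.sum_of_injective e he _ _
      (fun j hj => by
        rw [hsub, sparseVector_apply_of_notMem w hj, sparseVector_apply_of_notMem w' hj]
        simp) fun _ => rfl
  rw [EuclideanSpace.norm_sq_eq, ← hreindex, Fintype.sum_prod_type]
  calc (hammingDist w w' : ℝ) * (r / L) ^ 2
      = ∑ i, if w i ≠ w' i then (r / L) ^ 2 else 0 := by
        rw [← Finset.sum_filter, Finset.sum_const, nsmul_eq_mul, hammingDist]
    _ ≤ _ := Finset.sum_le_sum fun i _ => by
        by_cases h : w i = w' i
        · simp only [h, ne_eq, not_true, if_false]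
          positivity
        · rw [if_pos h]
          exact hblock i h

/-- Every point is close to few of the sparse vectors. -/
theorem sum_indicator_sparseVector_le (he : Function.Injective e) {ρ : ℝ} (hρ : 1 ≤ ρ)
    (hcard : ((q * L : ℕ) : ℝ) = ρ ^ 2) (z : EuclideanSpace ℝ (Fin p)) :
    ∑ w : Fin m → Fin q × Fin L,
      {z | ‖z - sparseVector e r w‖ ^ 2 < m * r ^ 2 / (8 * L ^ 2)}.indicator
        (fun _ => (1 : ℝ)) z ≤ (2 * ρ) ^ m := by
  classical
  simp only [Set.indicator_apply, Set.mem_ofPred_eq]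
  rw [← Finset.sum_filter, Finset.sum_const, nsmul_eq_mul, mul_one]
  rcases (Finset.univ.filter fun w : Fin m → Fin q × Fin L =>
    ‖z - sparseVector e r w‖ ^ 2 < m * r ^ 2 / (8 * L ^ 2)).eq_empty_or_nonempty with h | ⟨w, hw⟩
  · rw [h]
    simp only [Finset.card_empty, Nat.cast_zero]
    positivity
  refine le_trans ?_ (card_hammingDist_le (α := Fin q × Fin L) hρ (by simpa using hcard) w)
  refine Nat.cast_le.2 (Finset.card_le_card fun w' hw' => ?_)
  have h1 := (Finset.mem_filter.1 hw).2
  have h2 := (Finset.mem_filter.1 hw').2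
  refine Finset.mem_filter.2 ⟨Finset.mem_univ _, ?_⟩
  have h3 := hammingDist_mul_le_norm_sq (r := r) he w w'
  have h4 : ‖sparseVector e r w - sparseVector e r w'‖ ≤
      ‖z - sparseVector e r w‖ + ‖z - sparseVector e r w'‖ := by
    have := norm_sub_le (z - sparseVector e r w') (z - sparseVector e r w)
    rw [sub_sub_sub_cancel_left] at this
    linarith
  -- Two vectors close to the same `z` are close to each other, so all words counted lie in the
  -- Hamming ball of radius `m / 2` about any one of them.
  have h5 : (hammingDist w w' : ℝ) * (r / L) ^ 2 < m / 2 * (r / L) ^ 2 := by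
    have h6 : m / 2 * (r / L) ^ 2 = 4 * (m * r ^ 2 / (8 * L ^ 2)) := by ring
    have h7 := pow_le_pow_left₀ (norm_nonneg _) h4 2
    nlinarith [sq_nonneg (‖z - sparseVector e r w‖ - ‖z - sparseVector e r w'‖)]
  have h8 := lt_of_mul_lt_mul_right h5 (sq_nonneg _)
  have h9 : ((2 * hammingDist w w' : ℕ) : ℝ) ≤ m := by push_cast; linarith
  exact_mod_cast h9

end SparseVector

/-! ### The lower bound for a shared sparse parameter. -/

/-- Lower bound for the model in which the tasks in `T` share an `m`-sparse parameter and the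
parameters of the other tasks vanish. -/
theorem exists_sparse_lower_bound {K nT nS p : ℕ} {Ω : Type*} [MeasurableSpace Ω]
    {P : Measure Ω} [IsProbabilityMeasure P]
    {X : Obs K nT nS → Ω → EuclideanSpace ℝ (Fin p)} {ε : Obs K nT nS → Ω → ℝ}
    {v : Obs K nT nS → ℝ≥0} {Sig : Fin (K + 1) → Matrix (Fin p) (Fin p) ℝ} {κ τ γ : ℝ}
    (hκ : 0 < κ) (hτ : 0 < τ) (hγ : 0 < γ)
    (hX : IsSubGaussianDesign P X Sig κ) (hε : IsGaussianNoise P X ε v τ)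
    {est : (Obs K nT nS → EuclideanSpace ℝ (Fin p) × ℝ) → EuclideanSpace ℝ (Fin p)}
    (hest : Measurable est) {m : ℕ} (hm : 0 < m) (hp : 0 < p)
    (hmp : (m : ℝ) ≤ (p : ℝ) ^ (1 - γ)) (T : Finset (Fin (K + 1))) {n r : ℝ} (hr : 0 ≤ r)
    (hn : ((Finset.univ.filter fun i : Obs K nT nS => task i ∈ T).card : ℝ) ≤ n)
    (hnr : 16 * κ * τ * (n * r ^ 2) ≤ γ * Real.log p) :
    ∃ b : EuclideanSpace ℝ (Fin p), {j | b j ≠ 0}.ncard ≤ m ∧ ∑ j, |b j| ≤ m * r ∧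
      1 / 2 ≤ P.real {ω | m * r ^ 2 / (8 * (2 ^ 18) ^ 2) ≤
        ‖est (sample X ε (fun k => if k ∈ T then b else 0) ω) - b‖ ^ 2} := by
  classical
  have hp1 : (1 : ℝ) ≤ p := by exact_mod_cast hp
  have hp0 : (0 : ℝ) < p := by linarith
  have hmR : (0 : ℝ) < m := by exact_mod_cast hm
  -- The levels keep the alphabet `Fin q × Fin L` large even when `q = 1`: `ρ ≥ √(2 ^ 18) = 512`,
  -- hence `ρ / 2 ≥ 256` as the Fano step requires already for `m = 1`. Thus `p` need not be large.
  set L : ℕ := 2 ^ 18 with hL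
  set q : ℕ := p / m with hq
  have hmp' : m ≤ p := by
    have : (m : ℝ) ≤ p := hmp.trans <| by
      simpa using Real.rpow_le_rpow_of_exponent_le hp1 (by linarith : 1 - γ ≤ 1)
    exact_mod_cast this
  have hq1 : 1 ≤ q := (Nat.one_le_div_iff hm).2 hmp'
  -- Sparsity `m ≤ p ^ (1 - γ)` leaves about `p ^ γ` positions per block; the factor `2` absorbs the
  -- rounding, as `p < m * (q + 1) ≤ 2 * m * q`.
  have hqγ : (p : ℝ) ^ γ ≤ 2 * q := by
    have h1 : p < m * (q + 1) := by
      rw [hq]; exact Nat.lt_mul_div_succ p hm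
    have h2 : (p : ℝ) ≤ m * (q + 1) := by exact_mod_cast h1.le
    have h3 : (m : ℝ) * (p : ℝ) ^ γ ≤ p := by
      calc (m : ℝ) * (p : ℝ) ^ γ ≤ (p : ℝ) ^ (1 - γ) * (p : ℝ) ^ γ := by gcongr
        _ = p := by rw [← Real.rpow_add hp0]; simp
    have h4 : (1 : ℝ) ≤ q := by exact_mod_cast hq1
    have h5 : (m : ℝ) * (p : ℝ) ^ γ ≤ m * (2 * q) := by nlinarith
    exact le_of_mul_le_mul_left h5 hmR
  obtain ⟨e⟩ : Nonempty (Fin m × Fin q ↪ Fin p) :=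
    Function.Embedding.nonempty_of_card_le (by simpa [hq] using Nat.mul_div_le p m)
  set ρ : ℝ := √((q * L : ℕ) : ℝ) with hρ
  have hρ2 : ((q * L : ℕ) : ℝ) = ρ ^ 2 := (Real.sq_sqrt (Nat.cast_nonneg _)).symm
  have hρ512 : 512 ≤ ρ := by
    rw [hρ]
    refine Real.le_sqrt_of_sq_le ?_
    have : (1 : ℝ) ≤ q := by exact_mod_cast hq1
    push_cast [hL]
    linarith
  have hργ : γ * Real.log p ≤ 2 * Real.log (ρ / 2) := by
    have h1 : 2 * Real.log (ρ / 2) = Real.log (ρ ^ 2 / 4) := by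
      rw [show ρ ^ 2 / 4 = (ρ / 2) ^ 2 by ring, Real.log_pow]; norm_num
    rw [h1, ← Real.log_rpow hp0, ← hρ2]
    refine Real.log_le_log (by positivity) ?_
    have : (1 : ℝ) ≤ q := by exact_mod_cast hq1
    push_cast [hL]
    linarith
  -- The family has `ρ ^ (2 * m)` members and overlap at most `(2 * ρ) ^ m`; the ratio is exactly
  -- `exp l`.
  let l := (m : ℝ) * Real.log (ρ / 2)
  have hexp : Real.exp l = (ρ / 2) ^ m := by
    rw [Real.exp_nat_mul, Real.exp_log (by linarith)]
  have : Nonempty (Fin q × Fin L) := ⟨⟨0, hq1⟩, ⟨0, by simp [hL]⟩⟩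
  let A (w : Fin m → Fin q × Fin L) : Set (Obs K nT nS → EuclideanSpace ℝ (Fin p) × ℝ) :=
    est ⁻¹' {z | ‖z - sparseVector e r w‖ ^ 2 < m * r ^ 2 / (8 * L ^ 2)}
  have hA : ∀ w, MeasurableSet (A w) := fun w =>
    hest (measurableSet_lt (by fun_prop) measurable_const)
  obtain ⟨w, hw⟩ := exists_measureReal_sample_le_half hτ hX hε
    (fun w k => if k ∈ T then sparseVector e r w else 0) hA (V := (2 * ρ) ^ m) (l := l)
    (fun y => sum_indicator_sparseVector_le e.injective (by linarith) hρ2 (est y))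
    (by
      rw [Real.exp_neg, hexp, Fintype.card_fun, Fintype.card_prod, Fintype.card_fin,
        Fintype.card_fin, Fintype.card_fin, Nat.cast_pow, hρ2, ← div_eq_mul_inv, ← div_pow]
      refine le_of_eq (congrArg (· ^ m) ?_)
      field_simp)
    (by
      rw [hexp]
      calc (256 : ℝ) ≤ ρ / 2 := by linarith
        _ ≤ (ρ / 2) ^ m := le_self_pow₀ (by linarith) hm.ne')
    (by
      intro w
      have h1 : ∑ i : Obs K nT nS, ‖if task i ∈ T then sparseVector e r w else 0‖ ^ 2 ≤
          n * (m * r ^ 2) := by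
        calc _ = ∑ i : Obs K nT nS, if task i ∈ T then ‖sparseVector e r w‖ ^ 2 else 0 :=
              Finset.sum_congr rfl fun i _ => by split_ifs <;> simp
          _ = ((Finset.univ.filter fun i : Obs K nT nS => task i ∈ T).card : ℝ) *
              ‖sparseVector e r w‖ ^ 2 := by
              rw [← Finset.sum_filter, Finset.sum_const, nsmul_eq_mul]
          _ ≤ n * (m * r ^ 2) :=
              mul_le_mul hn (norm_sparseVector_sq_le e.injective hr w) (by positivity)
                (le_trans (Nat.cast_nonneg _) hn)
      have h2 := mul_le_mul_of_nonneg_left h1 (mul_pos hκ hτ).le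
      refine h2.trans ?_
      have h3 := mul_le_mul_of_nonneg_left (hnr.trans hργ) hmR.le
      simp only [l]
      linarith)
  refine ⟨sparseVector e r w, ncard_support_sparseVector_le e.injective w,
    sum_abs_sparseVector_le e.injective hr w, ?_⟩
  have hcompl := probReal_compl_eq_one_sub (μ := P)
    (measurable_sample hX.measurable hε.measurable
      (fun k => if k ∈ T then sparseVector e r w else 0) (hA w))
  have hset : {ω | m * r ^ 2 / (8 * (2 ^ 18) ^ 2) ≤
      ‖est (sample X ε (fun k => if k ∈ T then sparseVector e r w else 0) ω) -
        sparseVector e r w‖ ^ 2} =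
      (sample X ε (fun k => if k ∈ T then sparseVector e r w else 0) ⁻¹' A w)ᶜ := by
    ext ω
    simp only [A, hL, Set.mem_ofPred_eq, Set.mem_compl_iff, Set.mem_preimage, not_lt]
    norm_num
  rw [hset, hcompl]
  have : P.real (sample X ε (fun k => if k ∈ T then sparseVector e r w else 0) ⁻¹' A w) ≤ 1 / 2 :=
    hw
  linarith

end TransferRegression

/-! ### Choice of sparsity, amplitude and tasks for the two terms of the rate. -/

theorem proposition1 (κ τ α γ : ℝ) (hκ : 0 < κ) (hτ : 0 < τ) (hα : 0 < α) (hγ : 0 < γ) :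
    ∃ c : ℝ, 0 < c ∧ ∃ δ : ℝ, 0 < δ ∧
      ∀ (p s K nT nS : ℕ) (h : Fin K → ℝ),
        0 < nT →
        (∀ k, 0 ≤ h k) →
        (s : ℝ) ≤ (p : ℝ) ^ (1 - γ) →
        (s : ℝ) * Real.log p ≤ δ * (TransferRegression.totalSize K nT nS : ℝ) →
        (∀ k, TransferRegression.hbar nT nS h / α ≤ h k ∧
          h k ≤ α * TransferRegression.hbar nT nS h) →
        TransferRegression.hbar nT nS h * √(Real.log p / (nT : ℝ)) ≤ δ →
        ∀ (Ω : Type*) [MeasurableSpace Ω] (P : Measure Ω) [IsProbabilityMeasure P]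
          (X : TransferRegression.Obs K nT nS → Ω → EuclideanSpace ℝ (Fin p))
          (ε : TransferRegression.Obs K nT nS → Ω → ℝ)
          (Sig : Fin (K + 1) → Matrix (Fin p) (Fin p) ℝ)
          (v : TransferRegression.Obs K nT nS → ℝ≥0),
          TransferRegression.IsSubGaussianDesign P X Sig κ →
          TransferRegression.IsGaussianNoise P X ε v τ →
          ∀ est : (TransferRegression.Obs K nT nS → EuclideanSpace ℝ (Fin p) × ℝ) →
              EuclideanSpace ℝ (Fin p),
            Measurable est →
            ∃ β ∈ TransferRegression.paramSpace p s h,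
              1 / 2 ≤ P.real {ω | c * TransferRegression.rate p s nT nS h ≤
                ‖est (TransferRegression.sample X ε β ω) - β 0‖ ^ 2} := by
  -- The largest constant for which `n * r ^ 2 ≤ c₁ * log p` meets the hypothesis of
  -- `exists_sparse_lower_bound`.
  set c₁ : ℝ := γ / (16 * κ * τ) with hc₁
  have hc₁pos : 0 < c₁ := by positivity
  -- The three entries serve the terms `s log p / nT`, `hbar ^ 2` and `hbar √(log p / nT)`; the
  -- first also serves `s log p / N`.
  set c₀ : ℝ := min c₁ (min (1 / α ^ 2) (√c₁ / (2 * α))) with hc₀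
  have hc₀pos : 0 < c₀ := by positivity
  have hc₀1 : c₀ ≤ c₁ := min_le_left _ _
  have hc₀2 : c₀ ≤ 1 / α ^ 2 := (min_le_right _ _).trans (min_le_left _ _)
  have hc₀3 : c₀ ≤ √c₁ / (2 * α) := (min_le_right _ _).trans (min_le_right _ _)
  -- The `2` pays for replacing the sum of the two terms by the larger one; `8 * (2 ^ 18) ^ 2` comes
  -- from the separation radius.
  refine ⟨c₀ / (2 * (8 * (2 ^ 18) ^ 2)), by positivity, 1, one_pos, ?_⟩
  intro p s K nT nS h hnT hh hsp _ hhb _ Ω _ P _ X ε Sig v hX hε est hest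
  set N : ℝ := (TransferRegression.totalSize K nT nS : ℝ) with hN
  set H : ℝ := TransferRegression.hbar nT nS h with hH
  have hnTR : (0 : ℝ) < nT := by exact_mod_cast hnT
  have hNpos : 0 < N := by
    rw [hN, TransferRegression.totalSize]
    exact_mod_cast (by omega : 0 < K * nS + nT)
  have hH0 : 0 ≤ H := mul_nonneg (by positivity) (Finset.sum_nonneg fun k _ => hh k)
  have hlog0 : 0 ≤ Real.log p := Real.log_natCast_nonneg p
  -- Here the rate is at most `0`, so the zero parameter suffices; afterwards `s`, `p` and `log p`
  -- are positive.
  by_cases hdeg : (s : ℝ) * Real.log p = 0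
  · refine ⟨0, ⟨by simp, fun k => by simpa using hh k⟩, ?_⟩
    have hrate : TransferRegression.rate p s nT nS h ≤ 0 := by
      rw [TransferRegression.rate, hdeg, zero_div, zero_div, zero_add]
      exact min_le_left _ _
    have huniv : {ω | c₀ / (2 * (8 * (2 ^ 18) ^ 2)) * TransferRegression.rate p s nT nS h ≤
        ‖est (TransferRegression.sample X ε 0 ω) -
          (0 : Fin (K + 1) → EuclideanSpace ℝ (Fin p)) 0‖ ^ 2} = Set.univ :=
      Set.eq_univ_of_forall fun ω =>
        (mul_nonpos_of_nonneg_of_nonpos (by positivity) hrate).trans (by positivity)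
    rw [huniv, probReal_univ]
    norm_num
  have hs : 0 < s := Nat.pos_of_ne_zero fun h0 => hdeg (by simp [h0])
  have hp : 0 < p := Nat.pos_of_ne_zero fun h0 => hdeg (by simp [h0])
  have hlog : 0 < Real.log p := lt_of_le_of_ne hlog0 fun h0 => hdeg (by rw [← h0, mul_zero])
  set R₁ : ℝ := (s : ℝ) * Real.log p / N with hR₁
  set R₂ : ℝ := min ((s : ℝ) * Real.log p / (nT : ℝ))
      (min (H * √(Real.log p / (nT : ℝ))) (H ^ 2)) with hR₂
  have hrate : TransferRegression.rate p s nT nS h = R₁ + R₂ := rfl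
  have main : ∃ (m : ℕ) (T : Finset (Fin (K + 1))) (n r : ℝ), 0 < m ∧ m ≤ s ∧ 0 ≤ r ∧
      ((Finset.univ.filter fun i : TransferRegression.Obs K nT nS =>
        TransferRegression.task i ∈ T).card : ℝ) ≤ n ∧ n * r ^ 2 ≤ c₁ * Real.log p ∧
      0 ∈ T ∧ (T = Finset.univ ∨ m * r ≤ H / α) ∧ c₀ * (R₁ + R₂) ≤ 2 * (m * r ^ 2) := by
    rcases le_total R₂ R₁ with hR | hR
    · have hr2 : √(c₁ * Real.log p / N) ^ 2 = c₁ * Real.log p / N := Real.sq_sqrt (by positivity)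
      refine ⟨s, Finset.univ, N, √(c₁ * Real.log p / N), hs, le_rfl, Real.sqrt_nonneg _, ?_, ?_,
        Finset.mem_univ _, Or.inl rfl, ?_⟩
      · simp only [Finset.mem_univ, Finset.filter_true, Finset.card_univ, hN,
          TransferRegression.totalSize]
        simp [add_comm]
      · rw [hr2, mul_div_cancel₀ _ hNpos.ne']
      · rw [hr2]
        have h1 : (s : ℝ) * (c₁ * Real.log p / N) = c₁ * R₁ := by rw [hR₁]; ring
        have hR₁0 : 0 ≤ R₁ := by positivity
        rw [h1]
        nlinarith
    · have hcard : ((Finset.univ.filter fun i : TransferRegression.Obs K nT nS =>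
          TransferRegression.task i ∈ ({0} : Finset (Fin (K + 1)))).card : ℝ) ≤ nT := by
        have hsub : (Finset.univ.filter fun i : TransferRegression.Obs K nT nS =>
            TransferRegression.task i ∈ ({0} : Finset (Fin (K + 1)))) ⊆
            Finset.univ.image Sum.inl := by
          intro i hi
          rcases i with i | ⟨k, i⟩
          · exact Finset.mem_image_of_mem _ (Finset.mem_univ _)
          · simp [TransferRegression.task] at hi
        refine Nat.cast_le.2 ((Finset.card_le_card hsub).trans ?_)
        exact Finset.card_image_le.trans (by simp)
      -- The largest amplitude that `nT` observations cannot detect. The sparsity is then limited by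
      -- `s` and by the `ℓ¹` budget `H / α`.
      set r₀ : ℝ := √(c₁ * Real.log p / nT) with hr₀
      have hr₀2 : r₀ ^ 2 = c₁ * Real.log p / nT := Real.sq_sqrt (by positivity)
      have hr₀n : nT * r₀ ^ 2 = c₁ * Real.log p := by rw [hr₀2, mul_div_cancel₀ _ hnTR.ne']
      have hr₀pos : 0 < r₀ := Real.sqrt_pos.2 (by positivity)
      have hr₀s : r₀ = √c₁ * √(Real.log p / nT) := by
        rw [hr₀, mul_div_assoc, Real.sqrt_mul hc₁pos.le]
      have hHα : 0 ≤ H / α := by positivity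
      have hsum : R₁ + R₂ ≤ 2 * R₂ := by linarith
      have hbound : ∀ {y z : ℝ}, R₂ ≤ y → 0 ≤ y → c₀ * y ≤ z → c₀ * (R₁ + R₂) ≤ 2 * z := by
        intro y z h1 h2 h3
        nlinarith
      rcases lt_or_ge (H / α) r₀ with hlt | hge
      · refine ⟨1, {0}, nT, H / α, one_pos, hs, hHα, hcard, ?_, by simp, Or.inr (by simp), ?_⟩
        · rw [← hr₀n]
          gcongr
        · refine hbound ((min_le_right _ _).trans (min_le_right _ _)) (sq_nonneg H) ?_
          calc c₀ * H ^ 2 ≤ 1 / α ^ 2 * H ^ 2 := by gcongr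
            _ = _ := by rw [Nat.cast_one]; ring
      · have hone : 1 ≤ H / α / r₀ := (one_le_div hr₀pos).2 hge
        have hfl : 1 ≤ ⌊H / α / r₀⌋₊ := Nat.le_floor (by simpa using hone)
        -- As many entries of size `r₀` as sparsity and budget allow. If `s` is the limit, the term
        -- is `s log p / nT`; if the budget is, then `m * r₀ ^ 2` is about `r₀ * H / α`, the mixed
        -- term.
        refine ⟨min s ⌊H / α / r₀⌋₊, {0}, nT, r₀, lt_min hs hfl, min_le_left _ _, hr₀pos.le,
          hcard, hr₀n.le, by simp, Or.inr ?_, ?_⟩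
        · rw [← le_div_iff₀ hr₀pos]
          refine le_trans ?_ (Nat.floor_le (by positivity))
          exact_mod_cast min_le_right _ _
        · rcases le_total s ⌊H / α / r₀⌋₊ with hm | hm
          · rw [min_eq_left hm]
            refine hbound (min_le_left _ _) (by positivity) ?_
            rw [hr₀2]
            calc c₀ * (s * Real.log p / nT) ≤ c₁ * (s * Real.log p / nT) := by gcongr
              _ = _ := by ring
          · rw [min_eq_right hm]
            refine hbound ((min_le_right _ _).trans (min_le_left _ _)) (by positivity) ?_
            -- Rounding down loses at most a factor `2` since the floor is at least `1`; this is the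
            -- `2` in `√c₁ / (2 * α)`.
            have h1 : H / α / r₀ / 2 ≤ (⌊H / α / r₀⌋₊ : ℝ) := by
              have h2 := (Nat.lt_floor_add_one (H / α / r₀)).le
              have h3 : (1 : ℝ) ≤ ⌊H / α / r₀⌋₊ := by exact_mod_cast hfl
              linarith
            calc c₀ * (H * √(Real.log p / nT)) ≤ √c₁ / (2 * α) * (H * √(Real.log p / nT)) := by
                  gcongr
              _ = H / α * r₀ / 2 := by rw [hr₀s]; ring
              _ = H / α / r₀ / 2 * r₀ ^ 2 := by field_simp
              _ ≤ _ := by gcongr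
  obtain ⟨m, T, n, r, hm, hms, hr, hcard, hnr, h0T, hT, hc⟩ := main
  obtain ⟨b, hb0, hb1, hb⟩ := TransferRegression.exists_sparse_lower_bound hκ hτ hγ hX hε hest hm hp
    ((Nat.cast_le.2 hms).trans hsp) T hr hcard (by
      calc 16 * κ * τ * (n * r ^ 2) ≤ 16 * κ * τ * (c₁ * Real.log p) := by gcongr
        _ = γ * Real.log p := by rw [hc₁]; field_simp)
  refine ⟨fun k => if k ∈ T then b else 0, ⟨?_, fun k => ?_⟩, hb.trans ?_⟩
  · simp only [h0T, if_true]
    exact hb0.trans hms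
  · simp only [h0T, if_true]
    by_cases hk : k.succ ∈ T
    · simpa [hk] using hh k
    · rcases hT with hT | hT
      · exact absurd (hT ▸ Finset.mem_univ _) hk
      · simp only [hk, if_false, PiLp.zero_apply, zero_sub, abs_neg]
        exact hb1.trans (hT.trans (hhb k).1)
  · refine measureReal_mono fun ω hω => ?_
    simp only [Set.mem_ofPred_eq, h0T, if_true] at hω ⊢
    refine le_trans ?_ hω
    rw [hrate, div_mul_eq_mul_div, div_le_div_iff₀ (by positivity) (by positivity)]
    nlinarith
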